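/- Let $\kappa$ be an infinite regular cardinal. A category is called $\kappa$-lex if it has all $\kappa$-small limits (limits of diagrams whose shape has fewer than $\kappa$ morphisms), and a functor is called $\kappa$-lex if it preserves all $\kappa$-small limits. Let $\mathcal{C}$ be a small category that is $\kappa$-lex and regular (it has finite limits and coequalizers of kernel pairs, and regular epimorphisms are stable under pullback). Let $\mathbf{Lex}_\kappa(\mathcal{C},\mathbf{Set})$ be the category of $\kappa$-lex functors $\mathcal{C}\to\mathbf{Set}$ and all natural transformations between them, that is, a full subcategory of $\mathbf{Set}^{\mathcal{C}}$. Let $F,G:\mathcal{C}\to\mathbf{Set}$ be $\kappa$-lex functors and $\alpha:F\Rightarrow G$ a natural transformation. **Theorem.** The following are equivalent: 1. $\alpha$ is elementary, i.e. for every monomorphism $i:u\hookrightarrow x$ of $\mathcal{C}$ the naturality square $$\begin{array}{ccc} F(u) & \xrightarrow{F(i)} & F(x)\\ {\scriptstyle\alpha_u}\downarrow & & \downarrow{\scriptstyle\alpha_x}\\ G(u) & \xrightarrow{G(i)} & G(x)\end{array}$$ is a pullback in $\mathbf{Set}$; 2. $\alpha$ is a regular monomorphism in $\mathbf{Lex}_\kappa(\mathcal{C},\mathbf{Set})$,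 i.e. there are a $\kappa$-lex functor $H:\mathcal{C}\to\mathbf{Set}$ and natural transformations $\beta_1,\beta_2:G\Rightarrow H$ such that $\alpha$ is an equalizer of $\beta_1,\beta_2$ in $\mathbf{Lex}_\kappa(\mathcal{C},\mathbf{Set})$. -/

import Mathlib

open CategoryTheory Limits

universe w v u v' u'

/-- `C` is `κ`-lex: it has limits of all `κ`-small diagrams, i.e. of all diagrams whose shape
has fewer than `κ` morphisms. -/
class IsLexCategory (κ : Cardinal.{w}) (C : Type u) [Category.{v} C] : Prop where
  hasLimitsOfShape (J : Type w) [SmallCategory J] (hJ : HasCardinalLT (Arrow J) κ) :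
    HasLimitsOfShape J C

/-- The functor `F` is `κ`-lex: it preserves all `κ`-small limits. -/
class IsLexFunctor (κ : Cardinal.{w}) {C : Type u} [Category.{v} C] {D : Type u'} [Category.{v'} D]
    (F : C ⥤ D) : Prop where
  preservesLimitsOfShape (J : Type w) [SmallCategory J] (hJ : HasCardinalLT (Arrow J) κ) :
    PreservesLimitsOfShape J F

/-- The property of functors `C ⥤ D` of being `κ`-lex. -/
def lexFunctors (κ : Cardinal.{w}) (C : Type u) [Category.{v} C] (D : Type u') [Category.{v'} D] :
    ObjectProperty (C ⥤ D) :=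
  fun F => IsLexFunctor κ F

/-- The category `Lex_κ(C, D)` of `κ`-lex functors and all natural transformations. -/
abbrev LexCat (κ : Cardinal.{w}) (C : Type u) [Category.{v} C] (D : Type u') [Category.{v'} D] :=
  (lexFunctors κ C D).FullSubcategory

/-- A natural transformation is elementary if its naturality squares at monomorphisms are
pullbacks. -/
def IsElementary {C : Type u} [Category.{v} C] {D : Type u'} [Category.{v'} D]
    {F G : C ⥤ D} (α : F ⟶ G) : Prop :=
  ∀ ⦃U X : C⦄ (i : U ⟶ X), Mono i → IsPullback (F.map i) (α.app U) (α.app X) (G.map i)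

/-! Elementary implies regular: arrows `p : x ⟶ y` with `g : G x`, `f : F y` and `G p g = α f` form
a category with `κ`-small limits, so its opposite is `κ`-filtered. The colimit `H` of the functors
represented by the `x ×_y x` is then `κ`-lex, and the two projections induce a pair `G ⟶ H`
equalized by `α`. If the pair agrees on an element of `G w`, filteredness gives a stage where the
corresponding map `x ⟶ w` coequalizes the kernel pair of `p`, hence factors through the image of
`p`. Elementarity at the mono part of `p` places the element in the range of `α`
(`IsElementary.mem_range_of_kernelPair_comp_eq`). Conversely, representables are `κ`-lex, so by
Yoneda a regular mono is a pointwise equalizer; since `H i` is injective for monic `i`, the squares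
are pullbacks. -/

lemma preservesLimitsOfShape_of_isColimit_of_isCardinalFiltered {κ : Cardinal.{u}}
    [Fact κ.IsRegular] {C : Type u} [SmallCategory C] {J : Type u} [SmallCategory J]
    [IsCardinalFiltered J κ] {X : J ⥤ C ⥤ Type u} {c : Cocone X} (hc : IsColimit c)
    {K : Type u} [SmallCategory K] (hK : HasCardinalLT (Arrow K) κ)
    (hX : ∀ j, PreservesLimitsOfShape K (X.obj j)) : PreservesLimitsOfShape K c.pt := by
  refine ⟨fun {D} => ⟨fun {s} hs => ?_⟩⟩
  let F : K ⥤ (C ⥤ Type u) ⥤ Type u := D ⋙ evaluation C (Type u)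
  let t : Cone F := (evaluation C (Type u)).mapCone s
  -- Source and target of `η` both preserve the colimit `c`, the target because `κ`-filtered
  -- colimits commute with `κ`-small limits of sets; so invertibility at each `X.obj j` passes to
  -- `c.pt`.
  let η : t.pt ⟶ limit F := limit.lift F t
  let l (P : C ⥤ Type u) : IsLimit (((evaluation _ _).obj P).mapCone (limit.cone F)) :=
    isLimitOfPreserves _ (limit.isLimit F)
  have hη (P : C ⥤ Type u) : η.app P = (l P).lift (P.mapCone s) :=
    (l P).uniq (P.mapCone s) _ fun k => congr_app (limit.lift_π t k) P
  have hiso (P : C ⥤ Type u) : Nonempty (IsLimit (P.mapCone s)) ↔ IsIso (η.app P) := by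
    rw [hη]
    exact IsLimit.nonempty_isLimit_iff_isIso_lift (l P)
  rw [hiso]
  let h₁ : IsColimit (t.pt.mapCocone c) :=
    isColimitOfPreserves ((evaluation C (Type u)).obj s.pt) hc
  let h₂ : IsColimit ((limit F).mapCocone c) :=
    Functor.Accessible.Limits.isColimitMapCocone (limit.cone F) l κ hK c
      fun k => isColimitOfPreserves ((evaluation C (Type u)).obj (D.obj k)) hc
  have (j : J) : IsIso ((Functor.whiskerLeft X η).app j) :=
    (hiso _).1 ⟨isLimitOfPreserves (X.obj j) hs⟩
  have : IsIso (Functor.whiskerLeft X η) := NatIso.isIso_of_isIso_app _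
  have : η.app c.pt = (h₁.coconePointsIsoOfNatIso h₂ (asIso (Functor.whiskerLeft X η))).hom :=
    h₁.hom_ext fun j => by
      rw [IsColimit.comp_coconePointsIsoOfNatIso_hom]
      exact η.naturality _
  rw [this]
  infer_instance

/-! ### Arrow elements and their kernel pairs -/

section

variable {C : Type u} [SmallCategory C] {F G : C ⥤ Type u} (α : F ⟶ G)

/-- Objects are morphisms `p : x ⟶ y` of `C` together with a morphism from the map of
representables given by `p` to `α`, i.e. `g : G x` and `f : F y` with `G p g = α f`. -/
abbrev ArrowElements : Type u :=
  Comma (𝟭 G.Elements) (CategoryOfElements.map α)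

/-- Limits in a comma category need the right-hand functor to preserve them; here this can be tested
after projecting to `C`. -/
lemma hasLimitsOfShape_arrowElements {K : Type u} [SmallCategory K] [HasLimitsOfShape K C]
    [PreservesLimitsOfShape K F] [PreservesLimitsOfShape K G] :
    HasLimitsOfShape K (ArrowElements α) := by
  have : PreservesLimitsOfShape K (CategoryOfElements.map α ⋙ CategoryOfElements.π G) :=
    inferInstanceAs (PreservesLimitsOfShape K (CategoryOfElements.π F))
  have : PreservesLimitsOfShape K (CategoryOfElements.map α) :=
    preservesLimitsOfShape_of_reflects_of_preserves _ (CategoryOfElements.π G)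
  infer_instance

lemma isCardinalFiltered_op_of_hasLimitsOfShape {D : Type u'} [Category.{v'} D]
    (κ : Cardinal.{w}) [Fact κ.IsRegular]
    (h : ∀ (K : Type w) [SmallCategory K], HasCardinalLT (Arrow K) κ → HasLimitsOfShape K D) :
    IsCardinalFiltered Dᵒᵖ κ where
  nonempty_cocone {A _} P hA := by
    have := h Aᵒᵖ (by simpa using hA)
    exact ⟨coconeOfConeLeftOp (limit.cone P.leftOp)⟩

namespace ArrowElements

variable {α}

/-- The morphism of `C` underlying an object of `ArrowElements α`. -/
abbrev arrow (e : ArrowElements α) : e.left.1 ⟶ e.right.1 := e.hom.val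

lemma arrow_comp {e e' : ArrowElements α} (m : e ⟶ e') :
    m.left.val ≫ e'.arrow = e.arrow ≫ m.right.val :=
  congrArg Subtype.val m.w

lemma map_arrow (e : ArrowElements α) : G.map e.arrow e.left.2 = α.app _ e.right.2 :=
  e.hom.property

end ArrowElements

/-- The functor sending `p : x ⟶ y` to `x ×_y x`. -/
noncomputable def kernelPairFunctor [HasPullbacks C] : ArrowElements α ⥤ C where
  obj e := pullback e.arrow e.arrow
  map {e e'} m := pullback.lift (pullback.fst e.arrow e.arrow ≫ m.left.val)
    (pullback.snd e.arrow e.arrow ≫ m.left.val)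
    (by simp only [Category.assoc, ArrowElements.arrow_comp, pullback.condition_assoc])
  map_id e := by
    apply pullback.hom_ext
    · rw [pullback.lift_fst, Category.id_comp]; exact Category.comp_id _
    · rw [pullback.lift_snd, Category.id_comp]; exact Category.comp_id _
  map_comp m m' := by
    apply pullback.hom_ext
    · rw [pullback.lift_fst, Category.assoc, pullback.lift_fst, pullback.lift_fst_assoc,
        Category.assoc]; rfl
    · rw [pullback.lift_snd, Category.assoc, pullback.lift_snd, pullback.lift_snd_assoc,
        Category.assoc]; rfl

section

variable [HasPullbacks C]

/-- The cokernel pair of `α` in the category of `κ`-lex functors. -/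
noncomputable def lexCokernelPair : C ⥤ Type u :=
  colimit ((kernelPairFunctor α).op ⋙ coyoneda)

namespace lexCokernelPair

open Opposite

variable {α}

/-- The element of the cokernel pair given by a morphism out of a kernel pair. -/
noncomputable def mk (e : ArrowElements α) {z : C} (k : pullback e.arrow e.arrow ⟶ z) :
    (lexCokernelPair α).obj z :=
  (colimit.ι ((kernelPairFunctor α).op ⋙ coyoneda) (op e)).app z k

lemma map_mk (e : ArrowElements α) {z z' : C} (k : pullback e.arrow e.arrow ⟶ z) (h : z ⟶ z') :
    (lexCokernelPair α).map h (mk e k) = mk e (k ≫ h) :=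
  (NatTrans.naturality_apply
    (colimit.ι ((kernelPairFunctor α).op ⋙ coyoneda) (op e)) h k).symm

lemma mk_map_comp {e e' : ArrowElements α} (m : e ⟶ e') {z : C}
    (k : pullback e'.arrow e'.arrow ⟶ z) :
    mk e ((kernelPairFunctor α).map m ≫ k) = mk e' k :=
  congrArg (fun t => t.app z k) (colimit.w ((kernelPairFunctor α).op ⋙ coyoneda) m.op)

lemma mk_fst_comp {e e' : ArrowElements α} (m : e ⟶ e') {z : C} (k : e'.left.1 ⟶ z) :
    mk e (pullback.fst e.arrow e.arrow ≫ m.left.val ≫ k) =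
      mk e' (pullback.fst e'.arrow e'.arrow ≫ k) := by
  rw [← mk_map_comp m]
  congr 1
  exact (Category.assoc _ _ _).symm.trans ((pullback.lift_fst_assoc _ _ _ _).symm)

lemma mk_snd_comp {e e' : ArrowElements α} (m : e ⟶ e') {z : C} (k : e'.left.1 ⟶ z) :
    mk e (pullback.snd e.arrow e.arrow ≫ m.left.val ≫ k) =
      mk e' (pullback.snd e'.arrow e'.arrow ≫ k) := by
  rw [← mk_map_comp m]
  congr 1
  exact (Category.assoc _ _ _).symm.trans ((pullback.lift_snd_assoc _ _ _ _).symm)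

lemma exists_of_mk_eq [IsFiltered (ArrowElements α)ᵒᵖ] {e : ArrowElements α} {z : C}
    {k k' : pullback e.arrow e.arrow ⟶ z} (h : mk e k = mk e k') :
    ∃ (e' : ArrowElements α) (m : e' ⟶ e),
      (kernelPairFunctor α).map m ≫ k = (kernelPairFunctor α).map m ≫ k' := by
  obtain ⟨j, f, hf⟩ := (Types.FilteredColimit.isColimit_eq_iff'
    (isColimitOfPreserves ((evaluation C (Type u)).obj z)
      (colimit.isColimit ((kernelPairFunctor α).op ⋙ coyoneda))) (i := op e) k k').1 h
  exact ⟨j.unop, f.unop, hf⟩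

lemma exists_of_mk_fst_eq_mk_snd [IsFiltered (ArrowElements α)ᵒᵖ] {e : ArrowElements α}
    (h : mk e (pullback.fst e.arrow e.arrow) = mk e (pullback.snd e.arrow e.arrow)) :
    ∃ (e' : ArrowElements α) (m : e' ⟶ e),
      pullback.fst e'.arrow e'.arrow ≫ m.left.val =
        pullback.snd e'.arrow e'.arrow ≫ m.left.val := by
  obtain ⟨e', m, hm⟩ := exists_of_mk_eq h
  exact ⟨e', m, (pullback.lift_fst _ _ _).symm.trans (hm.trans (pullback.lift_snd _ _ _))⟩

end lexCokernelPair

end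

end

/-! ### Finite limits and elementary transformations -/

section

variable {C : Type u} [SmallCategory C]

lemma IsLexFunctor.preservesFiniteLimits {κ : Cardinal.{w}} (hκ : κ.IsRegular)
    {D : Type u'} [Category.{v'} D] (F : C ⥤ D) [IsLexFunctor κ F] : PreservesFiniteLimits F :=
  preservesFiniteLimits_of_preservesFiniteLimitsOfSize.{w} F fun J _ _ =>
    IsLexFunctor.preservesLimitsOfShape (κ := κ) J
      ((hasCardinalLT_of_finite (Arrow J) _ le_rfl).of_le hκ.aleph0_le)

instance isLexFunctor_coyoneda (κ : Cardinal.{w}) (X : Cᵒᵖ) :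
    IsLexFunctor κ (coyoneda.obj X) where
  preservesLimitsOfShape _ _ _ := inferInstance

lemma nonempty_unique_obj_terminal [HasTerminal C] (F : C ⥤ Type u) [PreservesFiniteLimits F] :
    Nonempty (Unique (F.obj (⊤_ C))) :=
  ⟨Types.isTerminalEquivUnique _ (IsTerminal.isTerminalObj F _ terminalIsTerminal)⟩

variable {F G : C ⥤ Type u}

/-- Elementarity is applied to the diagonal of `x`: the pair `(a, a')` is sent by `α` into the
diagonal of `G`, so it lies on that of `F`. -/
lemma IsElementary.injective [HasFiniteLimits C] [PreservesFiniteLimits F]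
    [PreservesFiniteLimits G] {α : F ⟶ G} (hα : IsElementary α) (x : C) :
    Function.Injective (α.app x) := by
  intro a a' h
  have hx := IsPullback.of_hasPullback (terminal.from x) (terminal.from x)
  obtain ⟨_⟩ := nonempty_unique_obj_terminal F
  obtain ⟨b, hb, hb'⟩ := Types.exists_of_isPullback (hx.map F) a a' (Subsingleton.elim _ _)
  have hG : α.app _ b = G.map (pullback.diagonal (terminal.from x)) (α.app x a) := by
    refine Types.ext_of_isPullback (hx.map G) ?_ ?_
    · rw [← NatTrans.naturality_apply, hb, ← Functor.map_comp_apply, pullback.diagonal_fst,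
        Functor.map_id_apply]
    · rw [← NatTrans.naturality_apply, hb', ← Functor.map_comp_apply, pullback.diagonal_snd,
        Functor.map_id_apply, h]
  obtain ⟨c, hc, -⟩ := Types.exists_of_isPullback
    (hα (pullback.diagonal (terminal.from x)) inferInstance) b (α.app x a) hG
  rw [← hb, ← hb', ← hc, ← Functor.map_comp_apply, ← Functor.map_comp_apply,
    pullback.diagonal_fst, pullback.diagonal_snd]

lemma IsElementary.mem_range_of_kernelPair_comp_eq [Regular C] {α : F ⟶ G}
    (hα : IsElementary α) (e : ArrowElements α) {w : C} (a : e.left.1 ⟶ w)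
    (ha : pullback.fst e.arrow e.arrow ≫ a = pullback.snd e.arrow e.arrow ≫ a) :
    ∃ c, α.app w c = G.map a e.left.2 := by
  have : HasCoequalizer (pullback.fst e.arrow e.arrow) (pullback.snd e.arrow e.arrow) :=
    Regular.hasCoequalizer_of_isKernelPair (IsKernelPair.of_hasPullback e.arrow)
  -- The regular epi–mono factorization of `e.arrow`; `i` is monic because `C` is regular.
  let q := coequalizer.π (pullback.fst e.arrow e.arrow) (pullback.snd e.arrow e.arrow)
  let i := coequalizer.desc e.arrow pullback.condition
  have hi : q ≫ i = e.arrow := coequalizer.π_desc _ _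
  obtain ⟨c, -, hc⟩ := Types.exists_of_isPullback (hα i inferInstance) e.right.2
    (G.map q e.left.2) (by rw [← Functor.map_comp_apply, hi, e.map_arrow])
  refine ⟨F.map (coequalizer.desc a ha) c, ?_⟩
  rw [NatTrans.naturality_apply, hc, ← Functor.map_comp_apply, coequalizer.π_desc]

end

/-! ### The coprojections and their equalizer -/

namespace lexCokernelPair

variable {C : Type u} [SmallCategory C] [HasFiniteLimits C] {F G : C ⥤ Type u}
  [PreservesFiniteLimits F] [PreservesFiniteLimits G] (α : F ⟶ G)

/-- An element of `G`, as an object of `ArrowElements α` over the morphism to the terminal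
object. -/
noncomputable def toTerminal {w : C} (g : G.obj w) : ArrowElements α where
  left := ⟨w, g⟩
  right := ⟨⊤_ C, (nonempty_unique_obj_terminal F).some.default⟩
  hom := ⟨terminal.from w, by
    obtain ⟨_⟩ := nonempty_unique_obj_terminal G
    exact Subsingleton.elim (α := G.obj (⊤_ C)) _ _⟩

/-- Morphisms to `toTerminal α g` are given by their component at the source. -/
noncomputable def homToTerminal {w : C} {g : G.obj w} (e : ArrowElements α) (h : e.left.1 ⟶ w)
    (hg : G.map h e.left.2 = g) : e ⟶ toTerminal α g where
  left := ⟨h, hg⟩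
  right := ⟨terminal.from _, by
    obtain ⟨_⟩ := nonempty_unique_obj_terminal F
    exact Subsingleton.elim (α := F.obj (⊤_ C)) _ _⟩
  w := Subtype.ext (Subsingleton.elim (α := (_ : C) ⟶ ⊤_ C) _ _)

/-- The first coprojection to the cokernel pair. -/
noncomputable def inl : G ⟶ lexCokernelPair α where
  app w := ↾fun g => mk (toTerminal α g) (pullback.fst _ _)
  naturality w w' h := by
    ext g
    refine Eq.trans ?_ (map_mk _ _ h).symm
    have := mk_fst_comp (homToTerminal α (toTerminal α g) h rfl) (𝟙 w')
    erw [Category.comp_id, Category.comp_id] at this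
    exact this.symm

/-- The second coprojection to the cokernel pair. -/
noncomputable def inr : G ⟶ lexCokernelPair α where
  app w := ↾fun g => mk (toTerminal α g) (pullback.snd _ _)
  naturality w w' h := by
    ext g
    refine Eq.trans ?_ (map_mk _ _ h).symm
    have := mk_snd_comp (homToTerminal α (toTerminal α g) h rfl) (𝟙 w')
    erw [Category.comp_id, Category.comp_id] at this
    exact this.symm

lemma condition : α ≫ inl α = α ≫ inr α := by
  ext w f
  -- An element coming from `F` lives over an identity, whose two kernel pair projections coincide.
  let e : ArrowElements α :=
    { left := ⟨w, α.app w f⟩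
      right := ⟨w, f⟩
      hom := 𝟙 _ }
  let m : e ⟶ toTerminal α (α.app w f) :=
    homToTerminal α e (𝟙 w) (Functor.map_id_apply G w _)
  have : Mono e.arrow := inferInstanceAs (Mono (𝟙 w))
  have h : pullback.fst e.arrow e.arrow = pullback.snd e.arrow e.arrow := by
    rw [← cancel_mono e.arrow, pullback.condition]
  have h₁ := mk_fst_comp m (𝟙 w)
  have h₂ := mk_snd_comp m (𝟙 w)
  rw [h] at h₁
  have := h₁.symm.trans h₂
  erw [Category.comp_id, Category.comp_id] at this
  exact this

lemma mem_range_of_inl_eq_inr {C : Type u} [SmallCategory C] [Regular C] {F G : C ⥤ Type u}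
    [PreservesFiniteLimits F] [PreservesFiniteLimits G] {α : F ⟶ G}
    [IsFiltered (ArrowElements α)ᵒᵖ] (hα : IsElementary α) {w : C} {g : G.obj w}
    (hg : (inl α).app w g = (inr α).app w g) : ∃ f, α.app w f = g := by
  obtain ⟨e, m, hm⟩ := exists_of_mk_fst_eq_mk_snd hg
  obtain ⟨c, hc⟩ := hα.mem_range_of_kernelPair_comp_eq e m.left.val hm
  exact ⟨c, hc.trans m.left.property⟩

end lexCokernelPair

section

variable {κ : Cardinal.{u}} [Fact κ.IsRegular] {C : Type u} [SmallCategory C]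
  [IsLexCategory κ C] {F G : C ⥤ Type u} [IsLexFunctor κ F] [IsLexFunctor κ G] (α : F ⟶ G)

variable (κ) in
lemma isCardinalFiltered_arrowElements_op : IsCardinalFiltered (ArrowElements α)ᵒᵖ κ :=
  isCardinalFiltered_op_of_hasLimitsOfShape κ fun K _ hK => by
    have := IsLexCategory.hasLimitsOfShape (κ := κ) (C := C) K hK
    have := IsLexFunctor.preservesLimitsOfShape (κ := κ) (F := F) K hK
    have := IsLexFunctor.preservesLimitsOfShape (κ := κ) (F := G) K hK
    exact hasLimitsOfShape_arrowElements α

variable (κ) in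
lemma isLexFunctor_lexCokernelPair [HasPullbacks C] : IsLexFunctor κ (lexCokernelPair α) where
  preservesLimitsOfShape K _ hK := by
    have := isCardinalFiltered_arrowElements_op κ α
    exact preservesLimitsOfShape_of_isColimit_of_isCardinalFiltered
      (colimit.isColimit ((kernelPairFunctor α).op ⋙ coyoneda)) hK
      fun j => inferInstanceAs (PreservesLimitsOfShape K (coyoneda.obj _))

end

/-! ### Regular monomorphisms and pointwise equalizers -/

section

variable {κ : Cardinal.{u}} {C : Type u} [SmallCategory C] {F G : LexCat κ C (Type u)}
  {α : F ⟶ G}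

/-- A natural transformation between `κ`-lex functors that is pointwise an equalizer is a
regular monomorphism. -/
lemma isRegularMono_of_app {H : LexCat κ C (Type u)} (β₁ β₂ : G ⟶ H) (h : α ≫ β₁ = α ≫ β₂)
    (hinj : ∀ x, Function.Injective (α.hom.app x))
    (hrange : ∀ x g, β₁.hom.app x g = β₂.hom.app x g → ∃ f, α.hom.app x f = g) :
    IsRegularMono α :=
  ⟨⟨{ Z := H
      left := β₁
      right := β₂
      w := h
      isLimit := Fork.IsLimit.ofExistsUnique fun s => by
        have hs (x : C) (y : s.pt.obj.obj x) : ∃ f, α.hom.app x f = s.ι.hom.app x y :=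
          hrange x _ (congrArg (fun t => t.hom.app x y) s.condition)
        choose l hl using hs
        refine ⟨⟨{ app := fun x => ↾(l x), naturality := fun x y f => ?_ }⟩, ?_, ?_⟩
        · ext t
          apply hinj
          refine (hl _ _).trans ?_
          refine (NatTrans.naturality_apply s.ι.hom f t).trans ?_
          refine Eq.trans ?_ (NatTrans.naturality_apply α.hom f _).symm
          exact congrArg (G.obj.map f) (hl x t).symm
        · ext x t
          exact hl x t
        · intro m hm
          ext x t
          apply hinj
          exact (congrArg (fun t' => t'.hom.app x t) hm).trans (hl x t).symm }⟩⟩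

lemma injective_app_of_mono [Mono α] (x : C) : Function.Injective (α.hom.app x) := by
  intro a a' h
  -- Elements at `x` are maps from this representable, so cancelling `α` gives injectivity.
  let Y : LexCat κ C (Type u) := ⟨coyoneda.obj (.op x), isLexFunctor_coyoneda κ _⟩
  let m (a : F.obj.obj x) : Y ⟶ F := ⟨coyonedaEquiv.symm a⟩
  have : m a = m a' := by
    rw [← cancel_mono α]
    ext : 1
    apply coyonedaEquiv.injective
    exact (coyonedaEquiv_comp _ _).trans ((by simpa [m] using h : α.hom.app x _ = α.hom.app x _).trans
      (coyonedaEquiv_comp _ _).symm)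
  exact coyonedaEquiv.symm.injective (congrArg (fun t => t.hom) this)

lemma CategoryTheory.RegularMono.mem_range_app (r : RegularMono α) {x : C} {g : G.obj.obj x}
    (hg : r.left.hom.app x g = r.right.hom.app x g) : ∃ f, α.hom.app x f = g := by
  let Y : LexCat κ C (Type u) := ⟨coyoneda.obj (.op x), isLexFunctor_coyoneda κ _⟩
  let m : Y ⟶ G := ⟨coyonedaEquiv.symm g⟩
  have hm : m ≫ r.left = m ≫ r.right := by
    ext : 1
    apply coyonedaEquiv.injective
    exact (coyonedaEquiv_comp _ _).trans ((by simpa [m] using hg :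
      r.left.hom.app x _ = r.right.hom.app x _).trans (coyonedaEquiv_comp _ _).symm)
  have hl : Fork.IsLimit.lift r.isLimit m hm ≫ α = m := Fork.IsLimit.lift_ι r.isLimit
  refine ⟨coyonedaEquiv (Fork.IsLimit.lift r.isLimit m hm).hom, ?_⟩
  rw [← coyonedaEquiv_comp]
  exact (congrArg (fun t => coyonedaEquiv t.hom) hl).trans (Equiv.apply_symm_apply _ _)

lemma CategoryTheory.RegularMono.isElementary [HasFiniteLimits C] (hκ : κ.IsRegular) (r : RegularMono α) :
    IsElementary α.hom := by
  intro U X i _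
  have := r.mono
  have : IsLexFunctor κ r.Z.obj := r.Z.property
  have := IsLexFunctor.preservesFiniteLimits hκ r.Z.obj
  refine (Types.isPullback_iff _ _ _ _).2 ⟨α.hom.naturality i, ?_, ?_⟩
  · rintro a a' ⟨-, h⟩
    exact injective_app_of_mono (α := α) U h
  · intro a b h
    obtain ⟨c, hc⟩ := r.mem_range_app (x := U) (g := b) (by
      -- The two maps need only agree on `b` after applying the injective `H i`, where `b` becomes
      -- the image of `a`.
      apply injective_of_mono (r.Z.obj.map i)
      rw [← NatTrans.naturality_apply, ← NatTrans.naturality_apply, ← h]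
      exact congrArg (fun t => t.hom.app X a) r.w)
    refine ⟨c, injective_app_of_mono (α := α) X ?_, hc⟩
    rw [NatTrans.naturality_apply, hc, h]

end

theorem mainTheorem6 (κ : Cardinal.{u}) (hκ : κ.IsRegular) (C : Type u) [SmallCategory C]
    [IsLexCategory κ C] [Regular C] (F G : LexCat κ C (Type u)) (α : F ⟶ G) :
    IsElementary α.hom ↔ IsRegularMono α := by
  refine ⟨fun hα => ?_, fun h => h.regularMono.some.isElementary hκ⟩
  have : Fact κ.IsRegular := ⟨hκ⟩
  have : IsLexFunctor κ F.obj := F.property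
  have : IsLexFunctor κ G.obj := G.property
  have := IsLexFunctor.preservesFiniteLimits hκ F.obj
  have := IsLexFunctor.preservesFiniteLimits hκ G.obj
  have := isCardinalFiltered_arrowElements_op κ α.hom
  have := isFiltered_of_isCardinalFiltered (ArrowElements α.hom)ᵒᵖ κ
  let H : LexCat κ C (Type u) :=
    ⟨lexCokernelPair α.hom, isLexFunctor_lexCokernelPair κ α.hom⟩
  exact isRegularMono_of_app (H := H) ⟨lexCokernelPair.inl α.hom⟩ ⟨lexCokernelPair.inr α.hom⟩
    (InducedCategory.hom_ext (lexCokernelPair.condition α.hom)) hα.injective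
    fun _ _ hg => lexCokernelPair.mem_range_of_inl_eq_inr hα hg
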